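/- Let $\mathbb K\langle z\rangle$ be one of the following three rings of functions: (i) the ring of entire functions $\mathbb C\to\mathbb C$, with $\mathbb K=\mathbb C$; (ii) the ring of entire functions $\mathbb C\to\mathbb C$ of the form $\sum_{n\ge 0}a_nz^n$ with all $a_n\in\mathbb R$, with $\mathbb K=\mathbb C$; (iii) the ring of real analytic functions $\mathbb R\to\mathbb R$, with $\mathbb K=\mathbb R$. Write $Z_f\subseteq\mathbb K$ for the zero set of $f$. Let $\mathcal D(\mathbb K)$ consist of all closed discrete subsets of $\mathbb K$ and of $\mathbb K$ itself. A discrete $z$-filter is a collection $\mathcal F\subseteq\mathcal D(\mathbb K)$ such that $\emptyset\notin\mathcal F$, such that $D_1\cap D_2\in\mathcal F$ for all $D_1,D_2\in\mathcal F$, and such that $D\in\mathcal F$ whenever $D_1\in\mathcal F$, $D\in\mathcal D(\mathbb K)$ and $D_1\subseteq D$. A discrete $z$-ultrafilter is a discrete $z$-filter that is maximal under inclusion. Let $\theta\mathbb K$ be the set of all discrete $z$-ultrafilters, write $\mathcal D^x$ for the ultrafilter belonging to $x\in\theta\mathbb K$, and for $Z\in\mathcal D(\mathbb K)$ let $\overline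 Z=\{x\in\theta\mathbb K: Z\in\mathcal D^x\}$. The sets $\overline Z$ are the basic closed sets of $\theta\mathbb K$, and their complements are the basic open sets; a basic open neighbourhood of $x$ is a basic open set containing $x$. Let $\eta_{\mathbb K}:\mathbb K\to\theta\mathbb K$ send $p$ to the discrete $z$-ultrafilter $\{Z\in\mathcal D(\mathbb K):p\in Z\}$. For $x\in\theta\mathbb K$ let $M^x$ be the ideal $\{f\in\mathbb K\langle z\rangle : Z_f\in\mathcal D^x\}$. Theorem. Let $x\in\theta\mathbb K\setminus\eta_{\mathbb K}(\mathbb K)$. Then to every basic open neighbourhood $U$ of $x$ one can assign a prime ideal $P_U$ of $\mathbb K\langle z\rangle$ with $P_U\subseteq M^x$, in such a way that $P_U\subsetneq P_{U'}$ whenever $U$ and $U'$ are basic open neighbourhoods of $x$ with $U\subsetneq U'$. In particular, for any two basic open neighbourhoods $U\subsetneq U'$ of $x$ there are prime ideals $P\subsetneq P'$ of $\mathbb K\langle z\rangle$ contained in $M^x$. -/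

import Mathlib

namespace DiscreteZ

open Set Topology

/-- The collection `𝒟(X)` of all closed discrete subsets of `X`, together with the special
member `X` itself. -/
def closedDiscrete (X : Type*) [TopologicalSpace X] : Set (Set X) :=
  {Z | (IsClosed Z ∧ IsDiscrete Z) ∨ Z = univ}

/-- Discrete `z`-filters on `X`. -/
structure IsDiscreteZFilter {X : Type*} [TopologicalSpace X] (F : Set (Set X)) : Prop where
  subset_closedDiscrete : F ⊆ closedDiscrete X
  empty_notMem : ∅ ∉ F
  inter_mem : ∀ D₁ ∈ F, ∀ D₂ ∈ F, D₁ ∩ D₂ ∈ F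
  mem_of_superset : ∀ D₁ ∈ F, ∀ D ∈ closedDiscrete X, D₁ ⊆ D → D ∈ F

/-- The set `θX` of all discrete `z`-ultrafilters on `X`, that is, of the discrete `z`-filters
that are maximal with respect to inclusion. -/
def Theta (X : Type*) [TopologicalSpace X] : Type _ :=
  {F : Set (Set X) // Maximal IsDiscreteZFilter F}

/-- The discrete `z`-ultrafilter `𝒟ˣ` belonging to a point `x` of `θX`. -/
def Theta.sets {X : Type*} [TopologicalSpace X] (x : Theta X) : Set (Set X) := x.1

/-- The set `Z̄` of all points `x` of `θX` with `Z ∈ 𝒟ˣ`. -/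
def Theta.bar {X : Type*} [TopologicalSpace X] (Z : Set X) : Set (Theta X) :=
  {x | Z ∈ x.sets}

/-- Basic open sets of `θX`: the complements of the basic closed sets `Z̄`, `Z ∈ 𝒟(X)`. -/
def Theta.IsBasicOpen {X : Type*} [TopologicalSpace X] (U : Set (Theta X)) : Prop :=
  ∃ Z ∈ closedDiscrete X, U = (Theta.bar Z)ᶜ

/-- The topology of `θX`. -/
instance Theta.instTopologicalSpace {X : Type*} [TopologicalSpace X] :
    TopologicalSpace (Theta X) :=
  TopologicalSpace.generateFrom {U | Theta.IsBasicOpen U}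

/-- Basic open neighbourhoods of a point of `θX`. -/
def Theta.IsBasicNhd {X : Type*} [TopologicalSpace X] (x : Theta X) (U : Set (Theta X)) : Prop :=
  Theta.IsBasicOpen U ∧ x ∈ U

theorem univ_mem_closedDiscrete (X : Type*) [TopologicalSpace X] :
    (univ : Set X) ∈ closedDiscrete X := Or.inr rfl

theorem inter_mem_closedDiscrete {X : Type*} [TopologicalSpace X] {Z₁ Z₂ : Set X}
    (h₁ : Z₁ ∈ closedDiscrete X) (h₂ : Z₂ ∈ closedDiscrete X) : Z₁ ∩ Z₂ ∈ closedDiscrete X := by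
  rcases h₁ with ⟨c₁, d₁⟩ | rfl
  · rcases h₂ with ⟨c₂, d₂⟩ | rfl
    · exact Or.inl ⟨c₁.inter c₂, d₁.mono inter_subset_left⟩
    · rw [inter_univ]
      exact Or.inl ⟨c₁, d₁⟩
  · rwa [univ_inter]

theorem singleton_mem_closedDiscrete {X : Type*} [TopologicalSpace X] [T1Space X] (p : X) :
    {p} ∈ closedDiscrete X :=
  Or.inl ⟨isClosed_singleton, (Set.subsingleton_singleton).isDiscrete⟩

/-- The whole space is a member of every discrete `z`-ultrafilter. -/
theorem Theta.univ_mem {X : Type*} [TopologicalSpace X] [Nonempty X] (x : Theta X) :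
    univ ∈ x.sets := by
  have hx : IsDiscreteZFilter x.sets := x.2.prop
  have h : IsDiscreteZFilter (insert univ x.sets) := by
    refine ⟨?_, ?_, ?_, ?_⟩
    · exact insert_subset (univ_mem_closedDiscrete X) hx.subset_closedDiscrete
    · rintro (h | h)
      · exact empty_ne_univ h
      · exact hx.empty_notMem h
    · rintro D₁ (rfl | h₁) D₂ (rfl | h₂)
      · simp
      · simp [h₂]
      · simp [h₁]
      · exact Or.inr (hx.inter_mem D₁ h₁ D₂ h₂)
    · rintro D₁ (rfl | h₁) D hD hsub
      · exact Or.inl (univ_subset_iff.1 hsub)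
      · exact Or.inr (hx.mem_of_superset D₁ h₁ D hD hsub)
  exact x.2.le_of_ge h (subset_insert _ _) (mem_insert _ _)

/-- The canonical map `η : X → θX`; it sends `p` to the discrete `z`-ultrafilter of all members
of `𝒟(X)` that contain `p`. -/
def eta {X : Type*} [TopologicalSpace X] [T1Space X] (p : X) : Theta X :=
  ⟨{Z | Z ∈ closedDiscrete X ∧ p ∈ Z}, by
    refine ⟨⟨fun Z h => h.1, fun h => h.2, fun D₁ h₁ D₂ h₂ =>
      ⟨inter_mem_closedDiscrete h₁.1 h₂.1, h₁.2, h₂.2⟩, fun D₁ h₁ D hD hs => ⟨hD, hs h₁.2⟩⟩, ?_⟩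
    intro F hF hle Z hZ
    refine ⟨hF.subset_closedDiscrete hZ, ?_⟩
    by_contra hp
    have h : {p} ∩ Z ∈ F :=
      hF.inter_mem _ (hle ⟨singleton_mem_closedDiscrete p, mem_singleton p⟩) _ hZ
    rw [singleton_inter_eq_empty.2 hp] at h
    exact hF.empty_notMem h⟩

/-- The ring of functions `𝕜 → 𝕜` that are analytic on the whole of `𝕜`, with the pointwise
operations. For `𝕜 = ℂ` these are the entire functions, and for `𝕜 = ℝ` the real analytic
functions on `ℝ`. -/
def analyticRing (𝕜 : Type*) [NontriviallyNormedField 𝕜] : Subring (𝕜 → 𝕜) where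
  carrier := {f | AnalyticOnNhd 𝕜 f univ}
  mul_mem' hf hg := AnalyticOnNhd.mul hf hg
  one_mem' := analyticOnNhd_const
  add_mem' hf hg := AnalyticOnNhd.add hf hg
  zero_mem' := analyticOnNhd_const
  neg_mem' hf := AnalyticOnNhd.neg hf

/-- The ring of entire functions `ℂ → ℂ` given by everywhere convergent power series
`∑ aₙ zⁿ` with real coefficients `aₙ`. -/
def realCoeffEntireRing : Subring (ℂ → ℂ) where
  carrier := {f | ∃ a : ℕ → ℝ, ∀ z : ℂ, HasSum (fun n => (a n : ℂ) * z ^ n) (f z)}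
  mul_mem' := by
    rintro f g ⟨a, ha⟩ ⟨b, hb⟩
    refine ⟨fun n => ∑ k ∈ Finset.HasAntidiagonal.antidiagonal n, a k.1 * b k.2, fun z => ?_⟩
    have h := (summable_norm_sum_mul_antidiagonal_of_summable_norm
      (ha z).summable.norm (hb z).summable.norm).of_norm.hasSum
    rw [← tsum_mul_tsum_eq_tsum_sum_antidiagonal_of_summable_norm
      (ha z).summable.norm (hb z).summable.norm, (ha z).tsum_eq, (hb z).tsum_eq] at h
    refine h.congr_fun ?_
    intro n
    push_cast
    rw [Finset.sum_mul]
    refine Finset.sum_congr rfl fun k hk => ?_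
    rw [← Finset.HasAntidiagonal.mem_antidiagonal.1 hk, pow_add]
    ring
  one_mem' := ⟨fun n => if n = 0 then 1 else 0, fun z => by
    have h := hasSum_ite_eq (0 : ℕ) (1 : ℂ)
    refine h.congr_fun ?_
    intro n
    by_cases hn : n = 0 <;> simp [hn]⟩
  add_mem' := by
    rintro f g ⟨a, ha⟩ ⟨b, hb⟩
    refine ⟨fun n => a n + b n, fun z => ?_⟩
    simpa [add_mul] using (ha z).add (hb z)
  zero_mem' := ⟨fun _ => 0, fun z => by simp [hasSum_zero]⟩
  neg_mem' := by
    rintro f ⟨a, ha⟩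
    refine ⟨fun n => - a n, fun z => ?_⟩
    simpa using (ha z).neg

theorem realCoeffEntireRing_le : realCoeffEntireRing ≤ analyticRing ℂ := by
  rintro f ⟨a, ha⟩
  let p := FormalMultilinearSeries.ofScalars ℂ (fun n => (a n : ℂ))
  have hr : p.radius = ⊤ := by
    refine p.radius_eq_top_of_summable_norm fun r => ?_
    refine (ha (r : ℝ)).summable.norm.congr fun n => ?_
    simp [p]
  have hp : HasFPowerSeriesOnBall f p 0 ⊤ := by
    refine ⟨hr.ge, by simp, fun {y} _ => ?_⟩
    have h := ha y
    simpa [p, FormalMultilinearSeries.ofScalars_apply_eq, mul_comm] using h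
  intro z _
  exact hp.analyticAt_of_mem (by simp)

/-- The zero set `Z_f` of a function `f`. -/
def zeroSet {𝕜 : Type*} [Zero 𝕜] (f : 𝕜 → 𝕜) : Set 𝕜 := {z | f z = 0}

theorem zeroSet_mem_closedDiscrete {𝕜 : Type*} [NontriviallyNormedField 𝕜] [PreconnectedSpace 𝕜]
    {f : 𝕜 → 𝕜} (hf : f ∈ analyticRing 𝕜) : zeroSet f ∈ closedDiscrete 𝕜 := by
  rcases AnalyticOnNhd.eqOn_zero_or_eventually_ne_zero_of_preconnected hf
    isPreconnected_univ with h | h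
  · exact Or.inr (eq_univ_of_forall fun z => h (mem_univ z))
  · exact Or.inl (compl_mem_codiscrete_iff.1 h)

/-- For a ring `A` of analytic functions on `𝕜` and a point `x` of `θ𝕜`, the ideal
`Mˣ = {f ∈ A : Z_f ∈ 𝒟ˣ}` of `A`. -/
def idealAt {𝕜 : Type*} [NontriviallyNormedField 𝕜] [PreconnectedSpace 𝕜]
    (A : Subring (𝕜 → 𝕜)) (hA : A ≤ analyticRing 𝕜) (x : Theta 𝕜) : Ideal A where
  carrier := {f | zeroSet (f : 𝕜 → 𝕜) ∈ x.sets}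
  add_mem' {f g} hf hg := by
    refine x.2.prop.mem_of_superset _ (x.2.prop.inter_mem _ hf _ hg) _
      (zeroSet_mem_closedDiscrete (hA (f + g).2)) ?_
    rintro z ⟨h₁, h₂⟩
    have h₁' : (f : 𝕜 → 𝕜) z = 0 := h₁
    have h₂' : (g : 𝕜 → 𝕜) z = 0 := h₂
    simp [zeroSet, h₁', h₂']
  zero_mem' := by
    have h : zeroSet ((0 : A) : 𝕜 → 𝕜) = univ := by
      ext z
      simp [zeroSet]
    simpa only [mem_ofPred_eq, h] using x.univ_mem
  smul_mem' c f hf := by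
    refine x.2.prop.mem_of_superset _ hf _ (zeroSet_mem_closedDiscrete (hA (c • f).2)) ?_
    intro z h
    have h' : (f : 𝕜 → 𝕜) z = 0 := h
    simp [zeroSet, h']

end DiscreteZ

/-! Fix a closed discrete `D` in the ultrafilter of `x`. For real `r`, let `growthIdeal` collect the
`f` such that, for every `k`, the order of `f` at `d` is at least `k (⌊‖d‖⌋ + 1) ^ r` for
ultrafilter-many `d ∈ D`. Orders add under products and the ultrafilter decides unions, so these
ideals are prime (`isPrime_growthIdeal`); positive order forces a zero, so they lie in `Mˣ`.

They strictly decrease in `r ≥ 0` (`growthIdeal_lt`): a function of order `⌈(⌊‖d‖⌋ + 1) ^ s⌉` on `D`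
separates `s` from every smaller `r`, because `x` contains no finite set. Such functions come from a
Weierstrass-type product over annuli, made symmetric under conjugation so that one construction
serves all three rings (`exists_realCoeff_analyticOrderAt_eq`).

Finally, inclusion of basic neighbourhoods reverses inclusion of closed discrete sets, and
`countingWeight` maps the latter strictly monotonically to the reals. Using the weight as the
exponent `r` reverses the order again. -/

namespace DiscreteZ

open Set Topology Filter

/-! ### Infinite products of entire functions. -/

section EntireProduct

variable {u : ℕ → ℂ → ℂ}

theorem summable_norm_of_le_half_pow
    (hb : ∀ (n : ℕ) (z : ℂ), 2 * ‖z‖ ≤ n → ‖u n z‖ ≤ (1 / 2 : ℝ) ^ n) (z : ℂ) :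
    Summable fun n => ‖u n z‖ := by
  refine summable_geometric_two.of_norm_bounded_eventually_nat ?_
  filter_upwards [eventually_ge_atTop ⌈2 * ‖z‖⌉₊] with n hn
  rw [norm_norm]
  exact hb n z (Nat.ceil_le.1 hn)

theorem differentiable_tprod_one_add (hd : ∀ n, Differentiable ℂ (u n))
    (hb : ∀ (n : ℕ) (z : ℂ), 2 * ‖z‖ ≤ n → ‖u n z‖ ≤ (1 / 2 : ℝ) ^ n) :
    Differentiable ℂ fun z => ∏' n, (1 + u n z) := by
  intro z
  have h : HasProdLocallyUniformlyOn (fun n x => 1 + u n x) (fun x => ∏' n, (1 + u n x))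
      (Metric.ball (0 : ℂ) (‖z‖ + 1)) := by
    refine Summable.hasProdLocallyUniformlyOn_nat_one_add Metric.isOpen_ball
      summable_geometric_two ?_ fun n => (hd n).continuous.continuousOn
    filter_upwards [eventually_ge_atTop ⌈2 * (‖z‖ + 1)⌉₊] with n hn x hx
    refine hb n x ?_
    have h1 := Nat.ceil_le.1 hn
    have h2 := mem_ball_zero_iff.1 hx
    linarith
  have h' := h.differentiableOn (.of_forall fun s => by
    simpa [Finset.prod_fn] using DifferentiableOn.finsetProd
      (fun n _ => ((hd n).const_add 1).differentiableOn)) Metric.isOpen_ball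
  exact h'.differentiableAt (Metric.isOpen_ball.mem_nhds (by simp))

/-- Factor `m` splits off. The remaining product, with `u m` replaced by `0`, is entire and nonzero
at `d`, so it contributes order `0`. -/
theorem analyticOrderAt_tprod_one_add (hd : ∀ n, Differentiable ℂ (u n))
    (hb : ∀ (n : ℕ) (z : ℂ), 2 * ‖z‖ ≤ n → ‖u n z‖ ≤ (1 / 2 : ℝ) ^ n) {d : ℂ} {m : ℕ}
    (hm : ∀ n, n ≠ m → 1 + u n d ≠ 0) :
    analyticOrderAt (fun z => ∏' n, (1 + u n z)) d = analyticOrderAt (fun z => 1 + u m z) d := by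
  let v : ℕ → ℂ → ℂ := Function.update u m 0
  have hvd : ∀ n, Differentiable ℂ (v n) := by
    intro n
    by_cases hn : n = m
    · subst hn
      simp [v]
    · simpa [v, hn] using hd n
  have hvb : ∀ (n : ℕ) (z : ℂ), 2 * ‖z‖ ≤ n → ‖v n z‖ ≤ (1 / 2 : ℝ) ^ n := by
    intro n z hz
    by_cases hn : n = m
    · subst hn
      simp [v]
    · simpa [v, hn] using hb n z hz
  have hfac : (fun z => ∏' n, (1 + u n z)) =
      (fun z => 1 + u m z) * fun z => ∏' n, (1 + v n z) := by
    ext z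
    have hv : Function.update (fun n => 1 + u n z) m 1 = fun n => 1 + v n z := by
      ext n
      by_cases hn : n = m
      · subst hn
        simp [v]
      · simp [v, hn]
    have hmul : Multipliable (Function.update (fun n => 1 + u n z) m 1) := by
      rw [hv]
      exact multipliable_one_add_of_summable (summable_norm_of_le_half_pow hvb z)
    rw [Pi.mul_apply, hmul.tprod_eq_mul_tprod_ite' m, ← hv]
    congr 2
    ext n
    simp [Function.update_apply]
  have hne : ∏' n, (1 + v n d) ≠ 0 := by
    refine tprod_one_add_ne_zero_of_summable (f := fun n => v n d) (fun n => ?_)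
      (summable_norm_of_le_half_pow hvb d)
    by_cases hn : n = m
    · subst hn
      simp [v]
    · simpa [v, hn] using hm n hn
  have hvan := (differentiable_tprod_one_add hvd hvb).analyticAt d
  rw [hfac, analyticOrderAt_mul (((hd m).const_add 1).analyticAt d) hvan,
    hvan.analyticOrderAt_eq_zero.2 hne, add_zero]

end EntireProduct

/-! ### Functions with prescribed orders. -/

/-- There are arbitrarily large exponents `N` such that `1` is the only `N`-th root of unity in a
given finite set. -/
theorem exists_pow_eq_one_imp_eq_one (S : Finset ℂ) :
    ∃ N : ℕ → ℕ, Tendsto N atTop atTop ∧ ∀ j, ∀ w ∈ S, w ^ N j = 1 → w = 1 := by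
  -- Every finite order occurring in `S` divides `M!`, hence is coprime to `M! * j + 1`. Elements of
  -- infinite order have `orderOf` equal to `0` and satisfy no such equation.
  let M := ∑ w ∈ S, orderOf w
  refine ⟨fun j => M.factorial * j + 1, ?_, fun j w hw h => ?_⟩
  · exact tendsto_atTop_mono (fun j => (Nat.le_mul_of_pos_left j M.factorial_pos).trans
      (Nat.le_succ _)) tendsto_id
  · have h1 : orderOf w ∣ M.factorial * j + 1 := orderOf_dvd_of_pow_eq_one h
    have h0 : 0 < orderOf w := Nat.pos_of_dvd_of_pos h1 (Nat.succ_pos _)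
    have h2 : orderOf w ∣ M.factorial :=
      Nat.dvd_factorial h0 (Finset.single_le_sum (f := fun w : ℂ => orderOf w) (fun _ _ => Nat.zero_le _) hw)
    have h3 : orderOf w ∣ 1 := (Nat.dvd_add_right (h2.mul_right j)).1 h1
    exact orderOf_eq_one_iff.1 (Nat.dvd_one.1 h3)

theorem analyticOrderAt_one_sub_div_pow {a : ℂ} (ha : a ≠ 0) {N : ℕ} (hN : N ≠ 0) :
    analyticOrderAt (fun z : ℂ => 1 - (z / a) ^ N) a = 1 := by
  have hd : HasDerivAt (fun z : ℂ => 1 - (z / a) ^ N) (-(N * (a / a) ^ (N - 1) * (1 / a))) a :=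
    (((hasDerivAt_id a).div_const a).pow N).const_sub 1
  refine AnalyticAt.analyticOrderAt_eq_one_of_zero_deriv_ne_zero ?_ ?_ ?_
  · fun_prop
  · simp [ha]
  · rw [hd.deriv]
    simp [ha, hN]

/-- An entire function close to `1` on a large disc, with zeros of order exactly `m` on a finite
subset of an annulus and no zeros outside that annulus. -/
theorem exists_entire_factor (A : Finset ℂ) (n m : ℕ) (hA0 : ∀ a ∈ A, a ≠ 0)
    (hA : ∀ a ∈ A, ⌊‖a‖⌋₊ = n) (hconj : ∀ a ∈ A, starRingEnd ℂ a ∈ A) :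
    ∃ u : ℂ → ℂ, Differentiable ℂ u ∧ (∀ z, 2 * ‖z‖ ≤ n → ‖u z‖ ≤ (1 / 2 : ℝ) ^ n) ∧
      (∀ z, 1 + u z = 0 → ⌊‖z‖⌋₊ = n) ∧ (∀ a ∈ A, analyticOrderAt (fun z => 1 + u z) a = m) ∧
      ∀ z, starRingEnd ℂ (u (starRingEnd ℂ z)) = u z := by
  classical
  obtain ⟨N, hN, hroot⟩ := exists_pow_eq_one_imp_eq_one (Finset.image₂ (fun a b => a / b) A A)
  have hlim : Tendsto (fun j => Real.exp (A.card * m * (1 / 2 : ℝ) ^ N j) - 1) atTop (𝓝 0) := by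
    have h := (tendsto_pow_atTop_nhds_zero_of_lt_one (by norm_num : (0 : ℝ) ≤ 1 / 2)
      (by norm_num)).comp hN
    have h' := ((Real.continuous_exp.tendsto _).comp (h.const_mul (A.card * m : ℝ))).sub_const 1
    simpa using h'
  obtain ⟨j, hj, hNj⟩ := ((hlim.eventually_lt_const (by positivity : (0 : ℝ) < (1 / 2) ^ n)).and
    (hN.eventually_gt_atTop 0)).exists
  set k := N j with hk
  -- All zeros have the modulus of some `a ∈ A`. The choice of `k` keeps the factor of any `b ≠ a`
  -- in `A` from vanishing at `a`, and makes `F` close to `1` where `‖z / a‖ ≤ 1 / 2`.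
  let F : ℂ → ℂ := fun z => ∏ a ∈ A, (1 - (z / a) ^ k) ^ m
  have hF : ∀ z, F z = ∏ p ∈ A ×ˢ Finset.range m, (1 + -(z / p.1) ^ k) := fun z => by
    simp [F, Finset.prod_product, sub_eq_add_neg]
  have hFd : Differentiable ℂ F := by
    refine Differentiable.fun_finsetProd fun a _ => ?_
    fun_prop
  refine ⟨fun z => F z - 1, hFd.sub_const 1, fun z hz => ?_, fun z hz => ?_, fun a ha => ?_,
    fun z => ?_⟩
  · refine le_trans ?_ hj.le
    change ‖F z - 1‖ ≤ _
    rw [hF]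
    refine (Finset.norm_prod_one_add_sub_one_le _ _).trans ?_
    gcongr
    refine (Finset.sum_le_card_nsmul _ _ ((1 / 2 : ℝ) ^ k) fun p hp => ?_).trans ?_
    · have hp1 := (Finset.mem_product.1 hp).1
      rw [norm_neg, norm_pow, norm_div]
      refine pow_le_pow_left₀ (by positivity) ?_ _
      rw [div_le_iff₀ (norm_pos_iff.2 (hA0 _ hp1))]
      have h1 := Nat.floor_le (norm_nonneg p.1)
      rw [hA _ hp1] at h1
      linarith
    · simp
  · rw [add_sub_cancel, Finset.prod_eq_zero_iff] at hz
    obtain ⟨a, ha, h⟩ := hz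
    have h1 : (z / a) ^ k = 1 := (sub_eq_zero.1 (eq_zero_of_pow_eq_zero h)).symm
    have h2 : ‖z / a‖ = 1 := Complex.norm_eq_one_of_pow_eq_one h1 hNj.ne'
    rw [norm_div, div_eq_one_iff_eq (norm_ne_zero_iff.2 (hA0 a ha))] at h2
    rw [h2, hA a ha]
  · have hsplit : (fun z => 1 + (F z - 1)) = (fun z : ℂ => 1 - (z / a) ^ k) ^ m *
        fun z => ∏ b ∈ A.erase a, (1 - (z / b) ^ k) ^ m := by
      ext z
      simp [F, ← Finset.mul_prod_erase A _ ha]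
    have han : AnalyticAt ℂ (fun z : ℂ => 1 - (z / a) ^ k) a := by fun_prop
    have han' : AnalyticAt ℂ (fun z : ℂ => ∏ b ∈ A.erase a, (1 - (z / b) ^ k) ^ m) a := by
      refine Finset.analyticAt_fun_prod _ fun b _ => ?_
      fun_prop
    rw [hsplit, analyticOrderAt_mul (han.pow m) han', analyticOrderAt_pow han,
      analyticOrderAt_one_sub_div_pow (hA0 a ha) hNj.ne', han'.analyticOrderAt_eq_zero.2]
    · simp
    · refine Finset.prod_ne_zero_iff.2 fun b hb => pow_ne_zero _ fun h => ?_
      obtain ⟨hba, hbA⟩ := Finset.mem_erase.1 hb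
      have h1 := hroot j (a / b) (Finset.mem_image₂_of_mem ha hbA) (sub_eq_zero.1 h).symm
      exact hba ((div_eq_one_iff_eq (hA0 b hbA)).1 h1).symm
  · change starRingEnd ℂ (F _ - 1) = F z - 1
    rw [map_sub, map_one]
    congr 1
    simp only [F, map_prod, map_pow, map_sub, map_one, map_div₀, Complex.conj_conj]
    exact Finset.prod_nbij' (starRingEnd ℂ) (starRingEnd ℂ) hconj hconj (by simp) (by simp)
      (by simp)

/-- Averaging the Taylor series with its conjugate replaces each coefficient by its real part
without changing the sum. -/
theorem mem_realCoeffEntireRing {f : ℂ → ℂ} (hf : Differentiable ℂ f)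
    (hconj : ∀ z, starRingEnd ℂ (f (starRingEnd ℂ z)) = f z) : f ∈ realCoeffEntireRing := by
  let c : ℕ → ℂ := fun n => (n.factorial : ℂ)⁻¹ * iteratedDeriv n f 0
  have h : ∀ z, HasSum (fun n => c n * z ^ n) (f z) := fun z => by
    refine (Complex.hasSum_taylorSeries_of_entire hf 0 z).congr_fun fun n => ?_
    simp only [c, sub_zero, smul_eq_mul]
    ring
  refine ⟨fun n => (c n).re, fun z => ?_⟩
  have h1 : HasSum (fun n => starRingEnd ℂ (c n) * z ^ n) (f z) := by
    have := (h (starRingEnd ℂ z)).map (starRingEnd ℂ) Complex.continuous_conj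
    rw [hconj] at this
    refine this.congr_fun fun n => ?_
    simp
  have h2 := ((h z).add h1).mul_left (1 / 2)
  have hz : 1 / 2 * (f z + f z) = f z := by ring
  rw [hz] at h2
  refine h2.congr_fun fun n => ?_
  rw [Complex.re_eq_add_conj]
  ring

/-- Entire functions with real Taylor coefficients and prescribed orders along a closed discrete
set that is stable under complex conjugation. -/
theorem exists_realCoeff_analyticOrderAt_eq {D : Set ℂ} (hD : IsClosed D) (hD' : IsDiscrete D)
    (hconj : ∀ d ∈ D, starRingEnd ℂ d ∈ D) (M : ℕ → ℕ) :
    ∃ f ∈ realCoeffEntireRing, ∀ d ∈ D, d ≠ 0 → analyticOrderAt f d = M ⌊‖d‖⌋₊ := by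
  -- The origin is left out because the factors divide by their zeros.
  have hfin : ∀ n : ℕ, {d ∈ D | d ≠ 0 ∧ ⌊‖d‖⌋₊ = n}.Finite := fun n => by
    refine (((isCompact_closedBall (0 : ℂ) (n + 1)).inter_left hD).finite
      (hD'.mono inter_subset_left)).subset ?_
    rintro d ⟨h1, -, h2⟩
    refine ⟨h1, mem_closedBall_zero_iff.2 ?_⟩
    rw [← h2]
    exact (Nat.lt_floor_add_one _).le
  choose u hd hb hzero hord hu using fun n => exists_entire_factor (hfin n).toFinset n (M n)
    (by simp +contextual) (by simp +contextual) (by simp +contextual [hconj])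
  refine ⟨_, mem_realCoeffEntireRing (differentiable_tprod_one_add hd hb) fun z => ?_,
    fun d hdD hd0 => ?_⟩
  · have hm := multipliable_one_add_of_summable
      (summable_norm_of_le_half_pow hb (starRingEnd ℂ z))
    rw [hm.map_tprod (starRingEnd ℂ) Complex.continuous_conj]
    simp [hu]
  · rw [analyticOrderAt_tprod_one_add hd hb (m := ⌊‖d‖⌋₊) fun n hn h => hn (hzero n d h).symm]
    exact hord _ d (by simp [hdD, hd0])

/-- The real part of the restriction to `ℝ` of an entire function with real Taylor coefficients
is real analytic, with the same orders at the points of `ℝ`. -/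
theorem analyticOrderAt_re_ofReal {f : ℂ → ℂ} (hf : f ∈ realCoeffEntireRing) (t : ℝ) {n : ℕ}
    (hn : analyticOrderAt f t = n) :
    analyticOrderAt (fun s : ℝ => (f s).re) t = n := by
  have hfa : AnalyticAt ℂ f t := realCoeffEntireRing_le hf t (mem_univ _)
  have him : ∀ s : ℝ, (f s).im = 0 := fun s => by
    obtain ⟨a, ha⟩ := hf
    refine HasSum.unique (Complex.hasSum_im (ha s)) ?_
    have h0 : ∀ n, ((a n : ℂ) * (s : ℂ) ^ n).im = 0 := fun n => by
      rw [← Complex.ofReal_pow, ← Complex.ofReal_mul, Complex.ofReal_im]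
    simp only [h0]
    exact hasSum_zero
  obtain ⟨h, hh, hne, heq⟩ := hfa.analyticOrderAt_eq_natCast.1 hn
  have heq' : ∀ᶠ s : ℝ in 𝓝 t, f s = ((s : ℂ) - t) ^ n • h s :=
    Complex.continuous_ofReal.continuousAt.eventually heq
  have hsplit : ∀ᶠ s : ℝ in 𝓝 t, (f s).re = (s - t) ^ n * (h s).re ∧
      (s - t) ^ n * (h s).im = 0 := by
    filter_upwards [heq'] with s hs
    have h1 : f s = (((s - t) ^ n : ℝ) : ℂ) * h s := by simpa using hs
    refine ⟨by rw [h1, Complex.re_ofReal_mul], ?_⟩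
    rw [← Complex.im_ofReal_mul, ← h1, him]
  -- The cofactor is real on the punctured line near `t`, hence at `t` by continuity; so `h t ≠ 0`
  -- gives a nonzero real part.
  have him0 : (h t).im = 0 := by
    have hc : Tendsto (fun s : ℝ => (h s).im) (𝓝[≠] t) (𝓝 (h t).im) :=
      (hh.im_ofReal.continuousAt.tendsto).mono_left nhdsWithin_le_nhds
    refine tendsto_nhds_unique hc (tendsto_const_nhds.congr' ?_)
    filter_upwards [hsplit.filter_mono nhdsWithin_le_nhds, self_mem_nhdsWithin] with s hs hst
    exact ((mul_eq_zero.1 hs.2).resolve_left (pow_ne_zero _ (sub_ne_zero.2 hst))).symm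
  refine (hfa.re_ofReal.analyticOrderAt_eq_natCast).2
    ⟨fun s : ℝ => (h s).re, hh.re_ofReal, fun h0 => hne (Complex.ext h0 him0), ?_⟩
  filter_upwards [hsplit] with s hs using hs.1

/-! ### Closed discrete sets and discrete `z`-ultrafilters. -/

theorem isClosed_isDiscrete_mono {X : Type*} [TopologicalSpace X] {S T : Set X}
    (hT : IsClosed T ∧ IsDiscrete T) (h : S ⊆ T) : IsClosed S ∧ IsDiscrete S := by
  rw [← compl_mem_codiscrete_iff] at hT ⊢
  exact mem_of_superset hT (compl_subset_compl.2 h)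

theorem isClosed_isDiscrete_union {X : Type*} [TopologicalSpace X] {S T : Set X}
    (hS : IsClosed S ∧ IsDiscrete S) (hT : IsClosed T ∧ IsDiscrete T) :
    IsClosed (S ∪ T) ∧ IsDiscrete (S ∪ T) := by
  rw [← compl_mem_codiscrete_iff] at hS hT ⊢
  rw [compl_union]
  exact inter_mem hS hT

theorem finite_inter_closedBall {E : Type*} [PseudoMetricSpace E] [ProperSpace E] {Z : Set E}
    (hZ : IsClosed Z ∧ IsDiscrete Z) (p : E) (R : ℝ) : (Z ∩ Metric.closedBall p R).Finite :=
  ((isCompact_closedBall p R).inter_left hZ.1).finite (hZ.2.mono inter_subset_left)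

namespace Theta

variable {X : Type*} [TopologicalSpace X] {x : Theta X}

theorem mem_or_mem_of_union_mem {A B : Set X} (hA : A ∈ closedDiscrete X)
    (hB : B ∈ closedDiscrete X) (h : A ∪ B ∈ x.sets) : A ∈ x.sets ∨ B ∈ x.sets := by
  have hx : IsDiscreteZFilter x.sets := x.2.prop
  by_cases hdisj : ∃ S ∈ x.sets, S ∩ A = ∅
  · obtain ⟨S, hS, hSA⟩ := hdisj
    refine Or.inr (hx.mem_of_superset _ (hx.inter_mem S hS _ h) B hB ?_)
    rw [inter_union_distrib_left, hSA, empty_union]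
    exact inter_subset_right
  · push Not at hdisj
    refine Or.inl ?_
    -- The filter generated by `x` and `A`; maximality of `x` puts `A` into `x`.
    let F : Set (Set X) := {Z | Z ∈ closedDiscrete X ∧ ∃ S ∈ x.sets, S ∩ A ⊆ Z}
    have hF : IsDiscreteZFilter F := by
      refine ⟨fun Z hZ => hZ.1, ?_, ?_, ?_⟩
      · rintro ⟨-, S, hS, hSA⟩
        exact (hdisj S hS).ne_empty (subset_empty_iff.1 hSA)
      · rintro D₁ ⟨h₁, S₁, hS₁, hs₁⟩ D₂ ⟨h₂, S₂, hS₂, hs₂⟩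
        refine ⟨inter_mem_closedDiscrete h₁ h₂, S₁ ∩ S₂, hx.inter_mem _ hS₁ _ hS₂, ?_⟩
        exact fun z hz => ⟨hs₁ ⟨hz.1.1, hz.2⟩, hs₂ ⟨hz.1.2, hz.2⟩⟩
      · rintro D₁ ⟨-, S, hS, hs⟩ D hD hsub
        exact ⟨hD, S, hS, hs.trans hsub⟩
    refine x.2.le_of_ge hF (fun Z hZ => ?_) ⟨hA, _, h, inter_subset_right⟩
    exact ⟨hx.subset_closedDiscrete hZ, Z, hZ, inter_subset_left⟩

theorem exists_notMem_of_notMem_range_eta [T1Space X] (hx : x ∉ range (eta : X → Theta X))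
    (p : X) : ∃ S ∈ x.sets, p ∉ S := by
  by_contra! h
  refine hx ⟨p, Subtype.ext ?_⟩
  have hle : x.1 ⊆ (eta p).1 := fun S hS => ⟨x.2.prop.subset_closedDiscrete hS, h S hS⟩
  exact (x.2.le_of_ge (eta p).2.prop hle).antisymm hle

theorem notMem_of_finite [T1Space X] (hx : x ∉ range (eta : X → Theta X))
    {S : Set X} (hS : S.Finite) : S ∉ x.sets := by
  induction S, hS using Set.Finite.induction_on with
  | empty => exact x.2.prop.empty_notMem
  | @insert a S _ hS ih =>
    intro h
    rw [insert_eq] at h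
    rcases mem_or_mem_of_union_mem (singleton_mem_closedDiscrete a)
      (Or.inl ⟨hS.isClosed, hS.isDiscrete⟩) h with h | h
    · obtain ⟨T, hT, haT⟩ := exists_notMem_of_notMem_range_eta hx a
      have h' := x.2.prop.inter_mem _ h _ hT
      rw [singleton_inter_eq_empty.2 haT] at h'
      exact x.2.prop.empty_notMem h'
    · exact ih h

theorem exists_isClosed_isDiscrete_mem [T1Space X] [Nonempty X]
    (hx : x ∉ range (eta : X → Theta X)) :
    ∃ D ∈ x.sets, IsClosed D ∧ IsDiscrete D := by
  obtain ⟨p⟩ := ‹Nonempty X›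
  obtain ⟨S, hS, hp⟩ := exists_notMem_of_notMem_range_eta hx p
  refine ⟨S, hS, (x.2.prop.subset_closedDiscrete hS).resolve_right ?_⟩
  rintro rfl
  exact hp (mem_univ p)

end Theta

/-! ### Prime ideals defined by growth of orders. -/

section Growth

variable {𝕜 : Type*} [NontriviallyNormedField 𝕜] {A : Subring (𝕜 → 𝕜)}

/-- The points `d` of `D` at which the order of `f` is at least `k (⌊‖d‖⌋ + 1) ^ r`. -/
def growthSet (D : Set 𝕜) (r : ℝ) (f : 𝕜 → 𝕜) (k : ℕ) : Set 𝕜 :=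
  {d ∈ D | (⌈k * ((⌊‖d‖⌋₊ : ℝ) + 1) ^ r⌉₊ : ℕ∞) ≤ analyticOrderAt f d}

theorem growthSet_anti (D : Set 𝕜) (r : ℝ) (f : 𝕜 → 𝕜) {k l : ℕ} (h : k ≤ l) :
    growthSet D r f l ⊆ growthSet D r f k := by
  rintro d ⟨hd, hl⟩
  refine ⟨hd, le_trans (Nat.cast_le.2 (Nat.ceil_mono ?_)) hl⟩
  gcongr

/-- The ideal of all `f` whose order along the ultrafilter `x` outgrows every multiple of
`(⌊‖d‖⌋ + 1) ^ r`. -/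
def growthIdeal (hA : A ≤ analyticRing 𝕜) (x : Theta 𝕜) {D : Set 𝕜}
    (hD : IsClosed D ∧ IsDiscrete D) (hDx : D ∈ x.sets) (r : ℝ) : Ideal A where
  carrier := {f | ∀ k, growthSet D r (f : 𝕜 → 𝕜) k ∈ x.sets}
  add_mem' {f g} hf hg k := by
    refine x.2.prop.mem_of_superset _ (x.2.prop.inter_mem _ (hf k) _ (hg k)) _
      (Or.inl (isClosed_isDiscrete_mono hD fun d h => h.1)) ?_
    rintro d ⟨h₁, h₂⟩
    exact ⟨h₁.1, (le_min h₁.2 h₂.2).trans le_analyticOrderAt_add⟩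
  zero_mem' k := by
    refine x.2.prop.mem_of_superset _ hDx _
      (Or.inl (isClosed_isDiscrete_mono hD fun d h => h.1)) fun d hd => ⟨hd, ?_⟩
    have h0 : analyticOrderAt ((0 : A) : 𝕜 → 𝕜) d = ⊤ :=
      analyticOrderAt_eq_top.2 (Eventually.of_forall fun z => rfl)
    rw [h0]
    exact le_top
  smul_mem' c f hf k := by
    refine x.2.prop.mem_of_superset _ (hf k) _
      (Or.inl (isClosed_isDiscrete_mono hD fun d h => h.1)) fun d hd => ⟨hd.1, ?_⟩
    have hm : analyticOrderAt ((c • f : A) : 𝕜 → 𝕜) d =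
        analyticOrderAt (c : 𝕜 → 𝕜) d + analyticOrderAt (f : 𝕜 → 𝕜) d :=
      analyticOrderAt_mul (hA c.2 d (mem_univ d)) (hA f.2 d (mem_univ d))
    rw [hm]
    exact hd.2.trans le_add_self

variable {hA : A ≤ analyticRing 𝕜} {x : Theta 𝕜} {D : Set 𝕜}
    {hD : IsClosed D ∧ IsDiscrete D} {hDx : D ∈ x.sets} {r s : ℝ}

theorem mem_growthIdeal {f : A} :
    f ∈ growthIdeal hA x hD hDx r ↔ ∀ k, growthSet D r (f : 𝕜 → 𝕜) k ∈ x.sets := Iff.rfl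

theorem growthIdeal_le_idealAt [PreconnectedSpace 𝕜] : growthIdeal hA x hD hDx r ≤ idealAt A hA x := by
  intro f hf
  refine x.2.prop.mem_of_superset _ (hf 1) _ (zeroSet_mem_closedDiscrete (hA f.2)) ?_
  rintro d ⟨-, hd⟩
  refine apply_eq_zero_of_analyticOrderAt_ne_zero (𝕜 := 𝕜) fun h0 => ?_
  rw [h0, nonpos_iff_eq_zero, Nat.cast_eq_zero, Nat.ceil_eq_zero] at hd
  have : 0 < ((1 : ℕ) : ℝ) * ((⌊‖d‖⌋₊ : ℝ) + 1) ^ r := by positivity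
  exact this.not_ge hd

/-- If the order of `f * g` reaches the bound for `2 * k`, then one factor reaches the bound for
`k`. The chosen factor may depend on `k`; monotonicity in `k` removes this dependence. -/
theorem isPrime_growthIdeal [PreconnectedSpace 𝕜] : (growthIdeal hA x hD hDx r).IsPrime := by
  refine ⟨fun htop => ?_, fun {f g} hfg => ?_⟩
  · have h1 : (1 : A) ∈ idealAt A hA x :=
      growthIdeal_le_idealAt (hD := hD) (hDx := hDx) (r := r) (htop ▸ Submodule.mem_top)
    have h0 : zeroSet ((1 : A) : 𝕜 → 𝕜) = ∅ := by
      ext z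
      simp [zeroSet]
    have h1' : zeroSet ((1 : A) : 𝕜 → 𝕜) ∈ x.sets := h1
    rw [h0] at h1'
    exact x.2.prop.empty_notMem h1'
  · have hcd : ∀ (h : A) k, growthSet D r (h : 𝕜 → 𝕜) k ∈ closedDiscrete 𝕜 := fun h k =>
      Or.inl (isClosed_isDiscrete_mono hD fun d h => h.1)
    have hk : ∀ k, growthSet D r (f : 𝕜 → 𝕜) k ∈ x.sets ∨ growthSet D r (g : 𝕜 → 𝕜) k ∈ x.sets := by
      intro k
      refine Theta.mem_or_mem_of_union_mem (hcd f k) (hcd g k)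
        (x.2.prop.mem_of_superset _ (hfg (2 * k)) _ (Or.inl (isClosed_isDiscrete_union
          (isClosed_isDiscrete_mono hD fun d h => h.1)
          (isClosed_isDiscrete_mono hD fun d h => h.1))) ?_)
      rintro d ⟨hd, hord⟩
      have hm : analyticOrderAt ((f * g : A) : 𝕜 → 𝕜) d =
          analyticOrderAt (f : 𝕜 → 𝕜) d + analyticOrderAt (g : 𝕜 → 𝕜) d :=
        analyticOrderAt_mul (hA f.2 d (mem_univ d)) (hA g.2 d (mem_univ d))
      by_contra hnot
      rw [mem_union, not_or] at hnot
      have hf := not_le.1 fun h => hnot.1 ⟨hd, h⟩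
      have hg := not_le.1 fun h => hnot.2 ⟨hd, h⟩
      rw [hm] at hord
      obtain ⟨a, ha⟩ := ENat.ne_top_iff_exists.1 hf.ne_top
      obtain ⟨b, hb⟩ := ENat.ne_top_iff_exists.1 hg.ne_top
      rw [← ha, Nat.cast_lt, Nat.lt_ceil] at hf
      rw [← hb, Nat.cast_lt, Nat.lt_ceil] at hg
      rw [← ha, ← hb, ← Nat.cast_add, Nat.cast_le, Nat.ceil_le] at hord
      push_cast at hord
      linarith
    by_contra hnot
    simp only [mem_growthIdeal, not_or, not_forall] at hnot
    obtain ⟨⟨k, hkf⟩, l, hlg⟩ := hnot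
    rcases hk (max k l) with h | h
    · exact hkf (x.2.prop.mem_of_superset _ h _ (hcd f k) (growthSet_anti _ _ _ (le_max_left _ _)))
    · exact hlg (x.2.prop.mem_of_superset _ h _ (hcd g l) (growthSet_anti _ _ _ (le_max_right _ _)))

theorem growthIdeal_lt [ProperSpace 𝕜] (hx : x ∉ range (eta : 𝕜 → Theta 𝕜))
    (hW : ∀ M : ℕ → ℕ, ∃ f ∈ A, ∀ d ∈ D, d ≠ 0 → analyticOrderAt f d = M ⌊‖d‖⌋₊)
    (hr : 0 ≤ r) (hrs : r < s) : growthIdeal hA x hD hDx s < growthIdeal hA x hD hDx r := by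
  have hcd : ∀ (h : 𝕜 → 𝕜) k, growthSet D r h k ∈ closedDiscrete 𝕜 := fun h k =>
      Or.inl (isClosed_isDiscrete_mono hD fun d h => h.1)
  refine lt_of_le_of_ne (fun f hf k => ?_) fun heq => ?_
  · refine x.2.prop.mem_of_superset _ (hf k) _ (hcd _ k) ?_
    rintro d ⟨hd, h⟩
    refine ⟨hd, le_trans (Nat.cast_le.2 (Nat.ceil_mono ?_)) h⟩
    gcongr
    simp
  · obtain ⟨f, hfA, hf⟩ := hW fun n => ⌈((n : ℝ) + 1) ^ s⌉₊
    have hfr : (⟨f, hfA⟩ : A) ∈ growthIdeal hA x hD hDx r := by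
      intro k
      have hlim : Tendsto (fun n : ℕ => ((n : ℝ) + 1) ^ (s - r)) atTop atTop :=
        (tendsto_rpow_atTop (sub_pos.2 hrs)).comp
          (tendsto_atTop_add_const_right _ _ tendsto_natCast_atTop_atTop)
      obtain ⟨R, hR⟩ := eventually_atTop.1 (hlim.eventually_ge_atTop (k : ℝ))
      -- Beyond radius `R` the ratio of the two growth rates exceeds `k`; the rest of `D` is finite
      -- and therefore negligible for `x`.
      have hsub : D ⊆ growthSet D r f k ∪ (D ∩ Metric.closedBall 0 R) := by
        intro d hd
        by_cases hdR : ‖d‖ ≤ R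
        · exact Or.inr ⟨hd, mem_closedBall_zero_iff.2 hdR⟩
        · refine Or.inl ⟨hd, ?_⟩
          rw [not_le] at hdR
          have hd0 : d ≠ 0 := by
            rintro rfl
            rw [norm_zero] at hdR
            exact hdR.not_ge (Nat.cast_nonneg R)
          rw [hf d hd hd0]
          refine Nat.cast_le.2 (Nat.ceil_mono ?_)
          have h1 := hR ⌊‖d‖⌋₊ (Nat.le_floor hdR.le)
          have h0 : (0 : ℝ) < (⌊‖d‖⌋₊ : ℝ) + 1 := by positivity
          rw [Real.rpow_sub h0, le_div_iff₀ (Real.rpow_pos_of_pos h0 r)] at h1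
          exact h1
      have hfin := finite_inter_closedBall hD 0 R
      have hB : IsClosed (D ∩ Metric.closedBall 0 (R : ℝ)) ∧
          IsDiscrete (D ∩ Metric.closedBall 0 (R : ℝ)) := ⟨hfin.isClosed, hfin.isDiscrete⟩
      refine (Theta.mem_or_mem_of_union_mem (hcd f k) (Or.inl hB)
        (x.2.prop.mem_of_superset _ hDx _ (Or.inl (isClosed_isDiscrete_union
          (isClosed_isDiscrete_mono hD fun d h => h.1) hB)) hsub)).resolve_right
        (Theta.notMem_of_finite hx hfin)
    rw [← heq] at hfr
    -- With `w = (⌊‖d‖⌋ + 1) ^ s ≥ 1`, one has `⌈w⌉ < w + 1 ≤ 2 * w`, so `k = 2` already fails at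
    -- every nonzero `d ∈ D`.
    refine Theta.notMem_of_finite hx ((finite_singleton (0 : 𝕜)).subset ?_) (hfr 2)
    rintro d ⟨hd, hord⟩
    by_contra hd0
    have hord' : ((⌈((2 : ℕ) : ℝ) * ((⌊‖d‖⌋₊ : ℝ) + 1) ^ s⌉₊ : ℕ) : ℕ∞) ≤
      analyticOrderAt f d := hord
    rw [hf d hd hd0, Nat.cast_le] at hord'
    have h1 : (1 : ℝ) ≤ ((⌊‖d‖⌋₊ : ℝ) + 1) ^ s :=
      Real.one_le_rpow (by simp) (hr.trans hrs.le)
    have h2 := Nat.ceil_lt_add_one (zero_le_one.trans h1)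
    have h3 := (Nat.le_ceil _).trans (Nat.cast_le (α := ℝ).2 hord')
    push_cast at h3
    linarith

end Growth

/-! ### A strictly monotone real weight on closed discrete sets. -/

section CountingWeight

variable {E : Type*} [SeminormedAddCommGroup E]

/-- A real number that measures the size of a closed discrete set by the numbers of its points in
the balls around the origin. -/
noncomputable def countingWeight (Z : Set E) : ℝ :=
  ∑' n : ℕ, (1 / 2 : ℝ) ^ n *
    (1 - 1 / (1 + ((Z ∩ Metric.closedBall 0 (n : ℝ)).ncard : ℝ)))

theorem countingWeight_term_nonneg (Z : Set E) (n : ℕ) : 0 ≤ (1 / 2 : ℝ) ^ n *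
    (1 - 1 / (1 + ((Z ∩ Metric.closedBall 0 (n : ℝ)).ncard : ℝ))) := by
  refine mul_nonneg (by positivity) (sub_nonneg.2 ?_)
  rw [div_le_one (by positivity)]
  simp

theorem summable_countingWeight (Z : Set E) : Summable fun n : ℕ => (1 / 2 : ℝ) ^ n *
    (1 - 1 / (1 + ((Z ∩ Metric.closedBall 0 (n : ℝ)).ncard : ℝ))) := by
  refine summable_geometric_two.of_nonneg_of_le (countingWeight_term_nonneg Z) fun n => ?_
  refine mul_le_of_le_one_right (by positivity) (sub_le_self _ (by positivity))

theorem countingWeight_nonneg (Z : Set E) : 0 ≤ countingWeight Z :=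
  tsum_nonneg (countingWeight_term_nonneg Z)

theorem countingWeight_lt [ProperSpace E] {Z Z' : Set E} (hZ' : IsClosed Z' ∧ IsDiscrete Z')
    (h : Z ⊂ Z') : countingWeight Z < countingWeight Z' := by
  obtain ⟨p, hp', hp⟩ := exists_of_ssubset h
  -- This ball contains the extra point `p`, so its count strictly increases.
  refine Summable.tsum_lt_tsum (i := ⌈‖p‖⌉₊) (fun n => ?_) ?_
    (summable_countingWeight Z) (summable_countingWeight Z')
  · have := ncard_le_ncard (inter_subset_inter_left (Metric.closedBall 0 (n : ℝ)) h.subset)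
      (finite_inter_closedBall hZ' 0 n)
    gcongr
  · have := ncard_lt_ncard (s := Z ∩ Metric.closedBall 0 (⌈‖p‖⌉₊ : ℝ))
      (t := Z' ∩ Metric.closedBall 0 (⌈‖p‖⌉₊ : ℝ))
      (ssubset_of_subset_of_ne (inter_subset_inter_left _ h.subset) fun heq => hp ?_)
      (finite_inter_closedBall hZ' 0 _)
    · gcongr
    · have : p ∈ Z' ∩ Metric.closedBall 0 (⌈‖p‖⌉₊ : ℝ) :=
        ⟨hp', mem_closedBall_zero_iff.2 (Nat.le_ceil _)⟩
      rw [← heq] at this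
      exact this.1

end CountingWeight

/-! ### Neighbourhoods of `x` and the three rings. -/

theorem Theta.subset_of_bar_subset {X : Type*} [TopologicalSpace X] [T1Space X] {Z Z' : Set X}
    (hZ : Z ∈ closedDiscrete X) (h : Theta.bar Z ⊆ Theta.bar Z') : Z ⊆ Z' := fun p hp =>
  (h (show eta p ∈ Theta.bar Z from ⟨hZ, hp⟩)).2

/-- If functions of `A` can have prescribed orders along a member of the ultrafilter of `x`, then
the basic open neighbourhoods of `x` embed into the prime ideals contained in `Mˣ`. -/
theorem exists_prime_family {𝕜 : Type*} [NontriviallyNormedField 𝕜] [PreconnectedSpace 𝕜]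
    [ProperSpace 𝕜] {A : Subring (𝕜 → 𝕜)} (hA : A ≤ analyticRing 𝕜) {x : Theta 𝕜}
    (hx : x ∉ range (eta : 𝕜 → Theta 𝕜)) {D : Set 𝕜} (hD : IsClosed D ∧ IsDiscrete D)
    (hDx : D ∈ x.sets)
    (hW : ∀ M : ℕ → ℕ, ∃ f ∈ A, ∀ d ∈ D, d ≠ 0 → analyticOrderAt f d = M ⌊‖d‖⌋₊) :
    ∃ P : Set (Theta 𝕜) → Ideal A,
      (∀ U, x.IsBasicNhd U → (P U).IsPrime ∧ P U ≤ idealAt A hA x) ∧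
      (∀ U U', x.IsBasicNhd U → x.IsBasicNhd U' → U ⊂ U' → P U < P U') := by
  classical
  -- The default `∅` is irrelevant, since neighbourhoods are basic open.
  let Z : Set (Theta 𝕜) → Set 𝕜 := fun U => if h : Theta.IsBasicOpen U then h.choose else ∅
  have hZ : ∀ U, Theta.IsBasicOpen U → Z U ∈ closedDiscrete 𝕜 ∧ U = (Theta.bar (Z U))ᶜ := by
    intro U hU
    simp only [Z, dif_pos hU]
    exact hU.choose_spec
  refine ⟨fun U => growthIdeal hA x hD hDx (countingWeight (Z U)),
    fun U _ => ⟨isPrime_growthIdeal, growthIdeal_le_idealAt⟩, fun U U' hU hU' hlt => ?_⟩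
  obtain ⟨hZU, hUeq⟩ := hZ U hU.1
  obtain ⟨hZU', hUeq'⟩ := hZ U' hU'.1
  -- The whole space is excluded because it belongs to every ultrafilter, so its complementary basic
  -- open set misses `x`.
  have hZcd : IsClosed (Z U) ∧ IsDiscrete (Z U) := by
    refine hZU.resolve_right fun huniv => ?_
    have h1 := hU.2
    rw [hUeq, huniv] at h1
    exact h1 x.univ_mem
  have hsub : Z U' ⊆ Z U := by
    refine Theta.subset_of_bar_subset hZU' ?_
    rw [← compl_subset_compl, ← hUeq, ← hUeq']
    exact hlt.subset
  refine growthIdeal_lt hx hW (countingWeight_nonneg _) (countingWeight_lt hZcd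
    (ssubset_of_subset_of_ne hsub fun heq => hlt.ne ?_))
  rw [hUeq, hUeq', heq]

theorem exists_conj_invariant_mem {x : Theta ℂ} (hx : x ∉ range (eta : ℂ → Theta ℂ)) :
    ∃ D ∈ x.sets, (IsClosed D ∧ IsDiscrete D) ∧ ∀ d ∈ D, starRingEnd ℂ d ∈ D := by
  obtain ⟨D, hDx, hD⟩ := Theta.exists_isClosed_isDiscrete_mem hx
  have hD' : IsClosed (starRingEnd ℂ ⁻¹' D) ∧ IsDiscrete (starRingEnd ℂ ⁻¹' D) :=
    ⟨hD.1.preimage Complex.continuous_conj,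
      hD.2.preimage Complex.continuous_conj.continuousOn (starRingEnd ℂ).injective⟩
  have hU := isClosed_isDiscrete_union hD hD'
  refine ⟨_, x.2.prop.mem_of_superset _ hDx _ (Or.inl hU) subset_union_left, hU, ?_⟩
  rintro d (h | h)
  · exact Or.inr (by simpa using h)
  · exact Or.inl h

theorem exists_real_analyticOrderAt_eq {D : Set ℝ} (hD : IsClosed D ∧ IsDiscrete D)
    (M : ℕ → ℕ) :
    ∃ f ∈ analyticRing ℝ, ∀ d ∈ D, d ≠ 0 → analyticOrderAt f d = M ⌊‖d‖⌋₊ := by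
  have hemb := Complex.isometry_ofReal.isClosedEmbedding
  obtain ⟨f, hf, hford⟩ := exists_realCoeff_analyticOrderAt_eq
    (D := Complex.ofReal '' D) (hemb.isClosedMap _ hD.1)
    (hD.2.image hemb.isEmbedding.isInducing) (by simp) M
  refine ⟨fun s => (f s).re, fun t _ => (realCoeffEntireRing_le hf t (mem_univ _)).re_ofReal,
    fun d hd hd0 => ?_⟩
  refine analyticOrderAt_re_ofReal hf d ?_
  rw [hford d (mem_image_of_mem _ hd) (by simpa using hd0), Complex.norm_real]

end DiscreteZ

theorem theorem3p12 :
    -- the ring of entire functions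
    (∀ x : DiscreteZ.Theta ℂ, x ∉ Set.range (DiscreteZ.eta : ℂ → DiscreteZ.Theta ℂ) →
      ∃ P : Set (DiscreteZ.Theta ℂ) → Ideal (DiscreteZ.analyticRing ℂ),
        (∀ U, x.IsBasicNhd U →
          (P U).IsPrime ∧ P U ≤ DiscreteZ.idealAt (DiscreteZ.analyticRing ℂ) le_rfl x) ∧
        (∀ U U', x.IsBasicNhd U → x.IsBasicNhd U' → U ⊂ U' → P U < P U')) ∧
    -- the ring of entire functions with real Taylor coefficients
    (∀ x : DiscreteZ.Theta ℂ, x ∉ Set.range (DiscreteZ.eta : ℂ → DiscreteZ.Theta ℂ) →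
      ∃ P : Set (DiscreteZ.Theta ℂ) → Ideal DiscreteZ.realCoeffEntireRing,
        (∀ U, x.IsBasicNhd U →
          (P U).IsPrime ∧ P U ≤ DiscreteZ.idealAt DiscreteZ.realCoeffEntireRing
            DiscreteZ.realCoeffEntireRing_le x) ∧
        (∀ U U', x.IsBasicNhd U → x.IsBasicNhd U' → U ⊂ U' → P U < P U')) ∧
    -- the ring of real analytic functions
    (∀ x : DiscreteZ.Theta ℝ, x ∉ Set.range (DiscreteZ.eta : ℝ → DiscreteZ.Theta ℝ) →
      ∃ P : Set (DiscreteZ.Theta ℝ) → Ideal (DiscreteZ.analyticRing ℝ),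
        (∀ U, x.IsBasicNhd U →
          (P U).IsPrime ∧ P U ≤ DiscreteZ.idealAt (DiscreteZ.analyticRing ℝ) le_rfl x) ∧
        (∀ U U', x.IsBasicNhd U → x.IsBasicNhd U' → U ⊂ U' → P U < P U')) := by

  refine ⟨fun x hx => ?_, fun x hx => ?_, fun x hx => ?_⟩
  · obtain ⟨D, hDx, hD, hconj⟩ := DiscreteZ.exists_conj_invariant_mem hx
    refine DiscreteZ.exists_prime_family le_rfl hx hD hDx fun M => ?_
    obtain ⟨f, hf, h⟩ := DiscreteZ.exists_realCoeff_analyticOrderAt_eq hD.1 hD.2 hconj M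
    exact ⟨f, DiscreteZ.realCoeffEntireRing_le hf, h⟩
  · obtain ⟨D, hDx, hD, hconj⟩ := DiscreteZ.exists_conj_invariant_mem hx
    exact DiscreteZ.exists_prime_family DiscreteZ.realCoeffEntireRing_le hx hD hDx
      (DiscreteZ.exists_realCoeff_analyticOrderAt_eq hD.1 hD.2 hconj)
  · obtain ⟨D, hDx, hD⟩ := DiscreteZ.Theta.exists_isClosed_isDiscrete_mem hx
    exact DiscreteZ.exists_prime_family le_rfl hx hD hDx
      (DiscreteZ.exists_real_analyticOrderAt_eq hD)
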